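/- Let $\mathcal{X}\subset\mathbb{R}^n$ be compact, $J:\mathcal{X}\to\mathbb{R}$ continuous, and let $\xi$ be a random vector in $\mathbb{R}^s$ with a continuous probability density $p\ge 0$ on a measurable set $\Xi\subseteq\mathbb{R}^s$, $\int_\Xi p=1$. Let $h:\mathcal{X}\times\Xi\to\mathbb{R}^m$ ($m\ge1$) be continuous, $\bar h(x,\xi):=\max_{1\le i\le m}h_i(x,\xi)$, and $\mathbb{P}(x):=\Pr\{\bar h(x,\xi)\le 0\}=\int_\Xi \mathbb{I}\{\bar h(x,\xi)\}p(\xi)\,d\xi$, where $\mathbb{I}\{y\}=1$ if $y\le0$ and $\mathbb{I}\{y\}=0$ otherwise. Let $\alpha\in[0,1]$. For $\beta\in[0,1]$ let $(Q_\beta)$ be the problem $\min\{J(x):x\in\mathcal{X},\ \mathbb{P}(x)\ge1-\beta\}$. Let $M(\mathcal{X})$ be the set of Borel probability measures on $\mathcal{X}$, and let $$\mathcal{J}^*_\alpha:=\inf\Big\{\int_{\mathcal X} J\,d\mu:\ \mu\in M(\mathcal{X}),\ \int_{\mathcal X}\mathbb{P}\,d\mu\ge1-\alpha\Big\},$$ with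 $A_\alpha$ the set of feasible $\mu$ attaining this infimum. Let $$\mathcal{Z}:=\{(\mu(1),\mu(2),x^{(1)},x^{(2)}):\ \mu(i)\in[0,1],\ \mu(1)+\mu(2)=1,\ x^{(i)}\in\mathcal{X}\}\subset\mathbb{R}^{2n+2},$$ with the Euclidean norm, and let $D_\alpha$ be the set of minimizers of $\sum_{i=1}^2J(x^{(i)})\mu(i)$ over all $z=(\mu(1),\mu(2),x^{(1)},x^{(2)})\in\mathcal{Z}$ with $\sum_{i=1}^2\mathbb{P}(x^{(i)})\mu(i)\ge1-\alpha$. For $\varepsilon>0$ let $\lambda_\varepsilon:[-\varepsilon,\varepsilon]\to[0,1]$ be continuously differentiable, strictly decreasing and symmetric about the point $(0,\tfrac12)$, i.e. $\lambda_\varepsilon(-y)=1-\lambda_\varepsilon(y)$, such that the function $\Lambda_\varepsilon$ with $\Lambda_\varepsilon(y)=0$ for $y\ge\varepsilon$, $\Lambda_\varepsilon(y)=\lambda_\varepsilon(y)$ for $-\varepsilon<y<\varepsilon$ and $\Lambda_\varepsilon(y)=1$ for $y\le-\varepsilon$ is continuously differentiable. Let $\xi^{(1)},\xi^{(2)},\dots$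 be independent copies of $\xi$, $\mathcal{D}_N=\{\xi^{(1)},\dots,\xi^{(N)}\}$, and for $\gamma\ge 0$ put $$\tilde{\mathbb{P}}^{\gamma,\varepsilon}_N(x):=\frac1N\sum_{j=1}^N\Lambda_\varepsilon\big(\bar h(x,\xi^{(j)})+\gamma\big).$$ Let $\tilde{\mathcal{J}}^{\gamma,\varepsilon}_\alpha(\mathcal{D}_N)$ and $\tilde D^{\gamma,\varepsilon}_\alpha(\mathcal{D}_N)$ be the optimal value and the set of optimal solutions of the sample-based smooth approximate problem of minimizing $\sum_{i=1}^2J(x^{(i)})\mu(i)$ over all $z\in\mathcal{Z}$ with $\sum_{i=1}^2\tilde{\mathbb{P}}^{\gamma,\varepsilon}_N(x^{(i)})\mu(i)\ge1-\alpha$. Suppose that: 1. for every $x\in\mathcal{X}$, $\Pr\{\xi\in\operatorname{supp}p,\ \bar h(x,\xi)=0\}=0$, where $\operatorname{supp}p$ is the closure of $\{\xi\in\Xi:p(\xi)>0\}$; 2. there is $\mu^*\in A_\alpha$ such that for every $\delta>0$ there is $\mu\in M(\mathcal{X})$, $\mu\ne\mu^*$, with $\int\mathbb{P}\,d\mu>1-\alpha$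 and $\big|\int J\,d\mu-\int J\,d\mu^*\big|\le\delta$; 3. for every $\beta\in(0,1]$ there is an optimal solution $\bar x_\beta$ of $(Q_\beta)$ such that for every $\eta>0$ there is $x\in\mathcal{X}$ with $\|x-\bar x_\beta\|\le\eta$ and $\mathbb{P}(x)>1-\beta$. Then for $\gamma=0$, with probability one, as $N\to\infty$ and $\varepsilon\downarrow0$ jointly: the approximate problem has an optimal solution for all sufficiently large $N$ and sufficiently small $\varepsilon>0$, $$\tilde{\mathcal{J}}^{0,\varepsilon}_\alpha(\mathcal{D}_N)\to\mathcal{J}^*_\alpha\qquad\text{and}\qquad\mathbb{D}\big(\tilde D^{0,\varepsilon}_\alpha(\mathcal{D}_N),D_\alpha\big)\to0,$$ where $\mathbb{D}(Z_1,Z_2):=\sup_{z\in Z_1}\inf_{z'\in Z_2}\|z-z'\|$. -/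

import Mathlib

open MeasureTheory ProbabilityTheory Filter Topology
open scoped ENNReal

noncomputable section

/-- Data of a chance constrained decision problem: a compact set `X ⊆ ℝⁿ` of decisions, a continuous
objective `J`, a random vector `ξ` in `ℝˢ` with a continuous density `p` on a sample set `Ξ`, and a
continuous constraint function `h : X × Ξ → ℝᵐ`. The values of `J`, `p`, `h` outside `X`, `Ξ`,
`X × Ξ` are irrelevant. -/
structure ChanceProblem (n s m : ℕ) where
  X : Set (EuclideanSpace ℝ (Fin n))
  J : EuclideanSpace ℝ (Fin n) → ℝ
  Ξ : Set (EuclideanSpace ℝ (Fin s))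
  p : EuclideanSpace ℝ (Fin s) → ℝ
  h : EuclideanSpace ℝ (Fin n) → EuclideanSpace ℝ (Fin s) → EuclideanSpace ℝ (Fin m)
  isCompact_X : IsCompact X
  continuousOn_J : ContinuousOn J X
  measurableSet_Ξ : MeasurableSet Ξ
  continuousOn_p : ContinuousOn p Ξ
  p_nonneg : ∀ ξ ∈ Ξ, 0 ≤ p ξ
  integral_p : ∫ ξ in Ξ, p ξ = 1
  continuousOn_h : ContinuousOn (fun q : EuclideanSpace ℝ (Fin n) × EuclideanSpace ℝ (Fin s) =>
    h q.1 q.2) (X ×ˢ Ξ)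

/-- `𝕀{y}`: `1` if `y ≤ 0` and `0` otherwise. -/
def nonposIndicator (y : ℝ) : ℝ := if y ≤ 0 then 1 else 0

/-- The function `Λ_ε` built from a profile `λ_ε` on `[-ε, ε]`. -/
def smoothIndicator (ε : ℝ) (lam : ℝ → ℝ) (y : ℝ) : ℝ :=
  if ε ≤ y then 0 else if y ≤ -ε then 1 else lam y

/-- `λ_ε : [-ε, ε] → [0, 1]` is continuously differentiable, strictly decreasing, symmetric about
the point `(0, 1/2)`, and makes `Λ_ε` continuously differentiable on `ℝ`. -/
structure IsSmoothingProfile (ε : ℝ) (lam : ℝ → ℝ) : Prop where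
  mapsTo : Set.MapsTo lam (Set.Icc (-ε) ε) (Set.Icc 0 1)
  strictAntiOn : StrictAntiOn lam (Set.Icc (-ε) ε)
  symmetric : ∀ y ∈ Set.Icc (-ε) ε, lam (-y) = 1 - lam y
  contDiffOn : ContDiffOn ℝ 1 lam (Set.Icc (-ε) ε)
  contDiff : ContDiff ℝ 1 (smoothIndicator ε lam)

/-- Variables `z = (μ(1), μ(2), x⁽¹⁾, x⁽²⁾)`, carrying the Euclidean norm of `ℝ^(2 + 2n)`. -/
abbrev TwoPoint (n : ℕ) : Type :=
  WithLp 2 (EuclideanSpace ℝ (Fin 2) × PiLp 2 fun _ : Fin 2 => EuclideanSpace ℝ (Fin n))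

/-- The weights `μ(i)`. -/
def TwoPoint.weight {n : ℕ} (z : TwoPoint n) (i : Fin 2) : ℝ := z.fst i

/-- The points `x⁽ⁱ⁾`. -/
def TwoPoint.point {n : ℕ} (z : TwoPoint n) (i : Fin 2) : EuclideanSpace ℝ (Fin n) := z.snd i

/-- The deviation `sup_{z ∈ Z₁} inf_{z' ∈ Z₂} ‖z - z'‖` of `Z₁` from `Z₂`, with values in
`[0, ∞]`. -/
def deviation {E : Type*} [NormedAddCommGroup E] (Z₁ Z₂ : Set E) : ℝ≥0∞ :=
  ⨆ z ∈ Z₁, ⨅ z' ∈ Z₂, ‖z - z'‖ₑ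

namespace ChanceProblem

variable {n s m : ℕ} (C : ChanceProblem n s m)

/-- The distribution of `ξ`, `A ↦ ∫_{A ∩ Ξ} p(ξ) dξ`. -/
def law : Measure (EuclideanSpace ℝ (Fin s)) :=
  (volume.restrict C.Ξ).withDensity fun ξ => ENNReal.ofReal (C.p ξ)

/-- `h̄(x, ξ) = max_i h_i(x, ξ)`. -/
def hbar [NeZero m] (x : EuclideanSpace ℝ (Fin n)) (ξ : EuclideanSpace ℝ (Fin s)) : ℝ :=
  Finset.univ.sup' Finset.univ_nonempty fun i : Fin m => C.h x ξ i

/-- `ℙ(x) = ∫_Ξ 𝕀{h̄(x, ξ)} p(ξ) dξ`. -/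
def satProb [NeZero m] (x : EuclideanSpace ℝ (Fin n)) : ℝ :=
  ∫ ξ in C.Ξ, nonposIndicator (C.hbar x ξ) * C.p ξ

/-! Deterministic decisions: problem `Q_α`. -/

def detFeasible [NeZero m] (α : ℝ) : Set (EuclideanSpace ℝ (Fin n)) :=
  {x ∈ C.X | 1 - α ≤ C.satProb x}

def detValue [NeZero m] (α : ℝ) : ℝ := sInf (C.J '' C.detFeasible α)

def detOptimal [NeZero m] (α : ℝ) : Set (EuclideanSpace ℝ (Fin n)) :=
  {x ∈ C.detFeasible α | C.J x = C.detValue α}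

/-! Probabilistic decisions: problem `P_α` over the Borel probability measures on `X`. -/

def measObjective (μ : ProbabilityMeasure C.X) : ℝ :=
  ∫ x : C.X, C.J x ∂(μ : Measure C.X)

def measSatProb [NeZero m] (μ : ProbabilityMeasure C.X) : ℝ :=
  ∫ x : C.X, C.satProb x ∂(μ : Measure C.X)

def measFeasible [NeZero m] (α : ℝ) : Set (ProbabilityMeasure C.X) :=
  {μ | 1 - α ≤ C.measSatProb μ}

/-- `𝒥*_α`. -/
def measValue [NeZero m] (α : ℝ) : ℝ := sInf (C.measObjective '' C.measFeasible α)

/-- `A_α`. -/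
def measOptimal [NeZero m] (α : ℝ) : Set (ProbabilityMeasure C.X) :=
  {μ ∈ C.measFeasible α | C.measObjective μ = C.measValue α}

/-- The pseudo-distance `𝒲_J(μ, ν) = |∫ J dμ - ∫ J dν|`. -/
def distJ (μ ν : ProbabilityMeasure C.X) : ℝ := |C.measObjective μ - C.measObjective ν|

/-! Two-point decisions: problem `W_α`. -/

/-- `𝒵 = {μ ∈ [0, 1]² : μ(1) + μ(2) = 1} × X²`. -/
def twoPointSet : Set (TwoPoint n) :=
  {z | (∀ i, z.weight i ∈ Set.Icc (0 : ℝ) 1) ∧ ∑ i, z.weight i = 1 ∧ ∀ i, z.point i ∈ C.X}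

def twoPointObjective (z : TwoPoint n) : ℝ := ∑ i, C.J (z.point i) * z.weight i

def twoPointFeasible [NeZero m] (α : ℝ) : Set (TwoPoint n) :=
  {z ∈ C.twoPointSet | 1 - α ≤ ∑ i, C.satProb (z.point i) * z.weight i}

def twoPointValue [NeZero m] (α : ℝ) : ℝ :=
  sInf (C.twoPointObjective '' C.twoPointFeasible α)

/-- `D_α`. -/
def twoPointOptimal [NeZero m] (α : ℝ) : Set (TwoPoint n) :=
  {z ∈ C.twoPointFeasible α | C.twoPointObjective z = C.twoPointValue α}

/-! The sample-based smooth approximation of `W_α`. Here `ξ 0, …, ξ (N - 1)` are the samples,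
`lam` is the profile `λ_ε`, and `γ` is a shift. -/

/-- `(1/N) ∑_j Λ_ε(h̄(x, ξ⁽ʲ⁾) + γ)`. -/
def sampleSatProb [NeZero m] (lam : ℝ → ℝ) (γ ε : ℝ) (N : ℕ) (ξ : ℕ → EuclideanSpace ℝ (Fin s))
    (x : EuclideanSpace ℝ (Fin n)) : ℝ :=
  (1 / (N : ℝ)) * ∑ j ∈ Finset.range N, smoothIndicator ε lam (C.hbar x (ξ j) + γ)

def sampleFeasible [NeZero m] (lam : ℝ → ℝ) (α γ ε : ℝ) (N : ℕ)
    (ξ : ℕ → EuclideanSpace ℝ (Fin s)) : Set (TwoPoint n) :=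
  {z ∈ C.twoPointSet | 1 - α ≤ ∑ i, C.sampleSatProb lam γ ε N ξ (z.point i) * z.weight i}

/-- The optimal value of the sample-based smooth approximate problem. -/
def sampleValue [NeZero m] (lam : ℝ → ℝ) (α γ ε : ℝ) (N : ℕ)
    (ξ : ℕ → EuclideanSpace ℝ (Fin s)) : ℝ :=
  sInf (C.twoPointObjective '' C.sampleFeasible lam α γ ε N ξ)

/-- The optimal solution set of the sample-based smooth approximate problem. -/
def sampleOptimal [NeZero m] (lam : ℝ → ℝ) (α γ ε : ℝ) (N : ℕ)
    (ξ : ℕ → EuclideanSpace ℝ (Fin s)) : Set (TwoPoint n) :=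
  {z ∈ C.sampleFeasible lam α γ ε N ξ |
    C.twoPointObjective z = C.sampleValue lam α γ ε N ξ}

/-! The three assumptions. -/

/-- For each `x ∈ X`, the set `{ξ ∈ supp p : h̄(x, ξ) = 0}` has probability zero. -/
def NullBoundary [NeZero m] : Prop :=
  ∀ x ∈ C.X, C.law {ξ ∈ closure {ξ ∈ C.Ξ | 0 < C.p ξ} | C.hbar x ξ = 0} = 0

/-- Some optimal measure of `P_α` is approximated, in the pseudo-distance `𝒲_J`, by strictly
feasible measures different from it. -/
def MeasApproximable [NeZero m] (α : ℝ) : Prop :=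
  ∃ μ' ∈ C.measOptimal α, ∀ δ > 0, ∃ μ : ProbabilityMeasure C.X,
    μ ≠ μ' ∧ 1 - α < C.measSatProb μ ∧ C.distJ μ μ' ≤ δ

/-- For every level `β ∈ (0, 1]`, some optimal solution of `Q_β` is approximated by strictly
feasible points. -/
def DetApproximable [NeZero m] : Prop :=
  ∀ β ∈ Set.Ioc (0 : ℝ) 1, ∃ x' ∈ C.detOptimal β, ∀ η > 0, ∃ x ∈ C.X,
    ‖x - x'‖ ≤ η ∧ 1 - β < C.satProb x

end ChanceProblem

end

/-! The proof has two halves. Almost surely, the smoothed empirical probabilities converge to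
`C.satProb` uniformly on `X`. The sample problem then only perturbs the constraint of the two-point
problem, which is stable because its domain is compact.

Uniform convergence: near a point `x`, both the smoothed indicator and the true one lie between the
indicators of `innerEvent x r` and `outerEvent x r` once `ε ≤ r`. These events have probabilities
close to `C.satProb x` for small `r` (`exists_radius`, using the null boundary). Finitely many balls
cover `X`, and the strong law applies to their events.

Values: a supporting line (`exists_multiplier`) bounds the objective below by an affine function of
`C.satProb`. Integrating it shows that no measure beats the best two-point decision. Applied at a
slightly stricter level, it turns a strictly feasible measure into a strictly feasible two-point
decision, which remains feasible for the samples and gives the upper bound.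
`exists_stability_radius` gives the lower bound and the convergence of the optimal solutions. -/

theorem smoothIndicator_mem_Icc_of_profile {ε : ℝ} {lam : ℝ → ℝ} (hlam : IsSmoothingProfile ε lam)
    (y : ℝ) : 0 ≤ smoothIndicator ε lam y ∧ smoothIndicator ε lam y ≤ 1 := by
  unfold smoothIndicator
  split_ifs with h₁ h₂
  · simp
  · simp
  · push Not at h₁ h₂
    exact hlam.mapsTo ⟨h₂.le, h₁.le⟩

/-! ### The law of the random vector and measurability. -/

namespace ChanceProblem

variable {n s m : ℕ} (C : ChanceProblem n s m)

/-- The Bochner integral of a non-integrable function is `0` by convention, which contradicts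
`integral_p`. -/
theorem integrableOn_p : IntegrableOn C.p C.Ξ := by
  by_contra h
  have := integral_undef h
  rw [C.integral_p] at this
  exact one_ne_zero this

theorem ae_nonneg_p : 0 ≤ᵐ[volume.restrict C.Ξ] C.p :=
  (ae_restrict_mem C.measurableSet_Ξ).mono C.p_nonneg

instance isProbabilityMeasure_law : IsProbabilityMeasure C.law := by
  constructor
  rw [law, withDensity_apply _ MeasurableSet.univ, Measure.restrict_univ,
    ← ofReal_integral_eq_lintegral_ofReal C.integrableOn_p C.ae_nonneg_p, C.integral_p,
    ENNReal.ofReal_one]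

theorem ae_law_mem_and_pos : ∀ᵐ ξ ∂C.law, ξ ∈ C.Ξ ∧ 0 < C.p ξ := by
  rw [law, ae_withDensity_iff' C.integrableOn_p.aestronglyMeasurable.aemeasurable.ennreal_ofReal]
  filter_upwards [ae_restrict_mem C.measurableSet_Ξ] with ξ hξ hp
  exact ⟨hξ, by simpa using hp⟩

/-- A relatively open subset of `Ξ` is measurable. -/
theorem measurableSet_of_relOpen {A : Set (EuclideanSpace ℝ (Fin s))} (hA : A ⊆ C.Ξ)
    (h : ∀ ξ ∈ A, A ∈ 𝓝[C.Ξ] ξ) : MeasurableSet A := by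
  choose! U hU using fun ξ hξ => mem_nhdsWithin.1 (h ξ hξ)
  have : A = (⋃ ξ ∈ A, U ξ) ∩ C.Ξ := by
    ext η
    constructor
    · intro hη
      exact ⟨Set.mem_biUnion hη (hU η hη).2.1, hA hη⟩
    · rintro ⟨hη, hΞ⟩
      obtain ⟨ξ, hξ, hξη⟩ := Set.mem_iUnion₂.1 hη
      exact (hU ξ hξ).2.2 ⟨hξη, hΞ⟩
  rw [this]
  exact (isOpen_biUnion fun ξ hξ => (hU ξ hξ).1).measurableSet.inter C.measurableSet_Ξ

variable [NeZero m]

theorem continuousOn_hbar :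
    ContinuousOn (fun q : EuclideanSpace ℝ (Fin n) × EuclideanSpace ℝ (Fin s) =>
      C.hbar q.1 q.2) (C.X ×ˢ C.Ξ) := by
  refine ContinuousOn.finset_sup'_apply (f := fun (i : Fin m)
    (q : EuclideanSpace ℝ (Fin n) × EuclideanSpace ℝ (Fin s)) => C.h q.1 q.2 i) _ fun i _ => ?_
  exact (EuclideanSpace.proj (𝕜 := ℝ) i).continuous.comp_continuousOn C.continuousOn_h

theorem continuousOn_hbar_left {ξ : EuclideanSpace ℝ (Fin s)} (hξ : ξ ∈ C.Ξ) :
    ContinuousOn (fun x => C.hbar x ξ) C.X :=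
  C.continuousOn_hbar.comp (f := fun x => (x, ξ)) (by fun_prop) fun _ hx => ⟨hx, hξ⟩

theorem continuousOn_hbar_right {x : EuclideanSpace ℝ (Fin n)} (hx : x ∈ C.X) :
    ContinuousOn (fun ξ => C.hbar x ξ) C.Ξ :=
  C.continuousOn_hbar.comp (f := fun ξ => (x, ξ)) (by fun_prop) fun _ hξ => ⟨hx, hξ⟩

/-! ### Local inner and outer events, and continuity of the satisfaction probability. -/

/-- The samples for which some decision within `r` of `x` has constraint value below `r`. -/
def outerEvent (x : EuclideanSpace ℝ (Fin n)) (r : ℝ) : Set (EuclideanSpace ℝ (Fin s)) :=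
  {ξ ∈ C.Ξ | ∃ x' ∈ C.X ∩ Metric.ball x r, C.hbar x' ξ < r}

/-- The samples for which all decisions within `r` of `x` have constraint value at most `-r`. -/
def innerEvent (x : EuclideanSpace ℝ (Fin n)) (r : ℝ) : Set (EuclideanSpace ℝ (Fin s)) :=
  {ξ ∈ C.Ξ | ∀ x' ∈ C.X ∩ Metric.ball x r, C.hbar x' ξ ≤ -r}

/-- The union over `x'` may be uncountable, but it is relatively open in `Ξ`: a witness `x'` for `ξ`
still works for nearby samples. -/
theorem measurableSet_outerEvent (x : EuclideanSpace ℝ (Fin n)) (r : ℝ) :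
    MeasurableSet (C.outerEvent x r) := by
  refine C.measurableSet_of_relOpen (fun _ h => h.1) ?_
  rintro ξ ⟨hξ, x', hx', hlt⟩
  filter_upwards [(C.continuousOn_hbar_right hx'.1 ξ hξ).eventually (gt_mem_nhds hlt),
    self_mem_nhdsWithin] with η h₁ h₂
  exact ⟨h₂, x', hx', h₁⟩

theorem measurableSet_innerEvent (x : EuclideanSpace ℝ (Fin n)) (r : ℝ) :
    MeasurableSet (C.innerEvent x r) := by
  have h : MeasurableSet {ξ ∈ C.Ξ | ∃ x' ∈ C.X ∩ Metric.ball x r, -r < C.hbar x' ξ} := by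
    refine C.measurableSet_of_relOpen (fun _ h => h.1) ?_
    rintro ξ ⟨hξ, x', hx', hlt⟩
    filter_upwards [(C.continuousOn_hbar_right hx'.1 ξ hξ).eventually (lt_mem_nhds hlt),
      self_mem_nhdsWithin] with η h₁ h₂
    exact ⟨h₂, x', hx', h₁⟩
  have e : C.innerEvent x r =
      C.Ξ \ {ξ ∈ C.Ξ | ∃ x' ∈ C.X ∩ Metric.ball x r, -r < C.hbar x' ξ} := by
    ext ξ
    simp only [innerEvent, Set.mem_ofPred_eq, Set.mem_sdiff, not_and, not_exists, not_lt]
    constructor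
    · rintro ⟨h₁, h₂⟩
      exact ⟨h₁, fun _ => h₂⟩
    · rintro ⟨h₁, h₂⟩
      exact ⟨h₁, h₂ h₁⟩
  rw [e]
  exact C.measurableSet_Ξ.diff h

theorem measurableSet_hbar_nonpos {x : EuclideanSpace ℝ (Fin n)} (hx : x ∈ C.X) :
    MeasurableSet {ξ ∈ C.Ξ | C.hbar x ξ ≤ 0} := by
  have h : MeasurableSet {ξ ∈ C.Ξ | 0 < C.hbar x ξ} := by
    refine C.measurableSet_of_relOpen (fun _ h => h.1) ?_
    rintro ξ ⟨hξ, hlt⟩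
    filter_upwards [(C.continuousOn_hbar_right hx ξ hξ).eventually (lt_mem_nhds hlt),
      self_mem_nhdsWithin] with η h₁ h₂
    exact ⟨h₂, h₁⟩
  have e : {ξ ∈ C.Ξ | C.hbar x ξ ≤ 0} = C.Ξ \ {ξ ∈ C.Ξ | 0 < C.hbar x ξ} := by
    ext ξ
    simp only [Set.mem_ofPred_eq, Set.mem_sdiff, not_and, not_lt]
    exact and_congr_right fun h => ⟨fun h' _ => h', fun h' => h' h⟩
  rw [e]
  exact C.measurableSet_Ξ.diff h

theorem satProb_eq_measureReal {x : EuclideanSpace ℝ (Fin n)} (hx : x ∈ C.X) :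
    C.satProb x = C.law.real {ξ ∈ C.Ξ | C.hbar x ξ ≤ 0} := by
  have hA := C.measurableSet_hbar_nonpos hx
  set A := {ξ ∈ C.Ξ | C.hbar x ξ ≤ 0} with hAdef
  have h₁ : C.satProb x = ∫ ξ in C.Ξ, A.indicator C.p ξ := by
    refine setIntegral_congr_fun C.measurableSet_Ξ fun ξ hξ => ?_
    by_cases h : C.hbar x ξ ≤ 0
    · have : ξ ∈ A := ⟨hξ, h⟩
      simp [nonposIndicator, h, this]
    · have : ξ ∉ A := fun h' => h h'.2
      simp [nonposIndicator, h, this]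
  rw [h₁, integral_indicator hA, integral_eq_lintegral_of_nonneg_ae
    (ae_restrict_of_ae C.ae_nonneg_p) C.integrableOn_p.aestronglyMeasurable.restrict,
    measureReal_def, law, withDensity_apply _ hA]

/-- The outer and inner events squeeze the satisfaction probability. -/
theorem exists_radius (h_null : C.NullBoundary) {x : EuclideanSpace ℝ (Fin n)} (hx : x ∈ C.X)
    {δ : ℝ} (hδ : 0 < δ) :
    ∃ r > 0, C.law.real (C.outerEvent x r) < C.satProb x + δ ∧
      C.satProb x - δ < C.law.real (C.innerEvent x r) := by
  let r : ℕ → ℝ := fun k => 1 / ((k : ℝ) + 1)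
  have hr : ∀ k, 0 < r k := fun k => Nat.one_div_pos_of_nat
  have hr_lim : Tendsto r atTop (𝓝 0) := tendsto_one_div_add_atTop_nhds_zero_nat
  have hr_anti : Antitone r := fun i j hij => Nat.one_div_le_one_div hij
  have hcont : ∀ ξ ∈ C.Ξ, ∀ b : ℝ × ℝ, C.hbar x ξ ∈ Set.Ioo b.1 b.2 →
      ∀ᶠ k in atTop, ∀ x' ∈ C.X ∩ Metric.ball x (r k), C.hbar x' ξ ∈ Set.Ioo b.1 b.2 := by
    intro ξ hξ b hb
    have := (C.continuousOn_hbar_left hξ x hx).eventually (isOpen_Ioo.mem_nhds hb)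
    obtain ⟨ρ, hρ, H⟩ := Metric.mem_nhdsWithin_iff.1 this
    filter_upwards [hr_lim.eventually (gt_mem_nhds hρ)] with k hk x' hx'
    exact H ⟨Metric.ball_subset_ball hk.le hx'.2, hx'.1⟩
  have houter : Tendsto (fun k => C.law.real (C.outerEvent x (r k))) atTop (𝓝 (C.satProb x)) := by
    have hlim := tendsto_measure_iInter_atTop (μ := C.law) (s := fun k => C.outerEvent x (r k))
      (fun k => (C.measurableSet_outerEvent x (r k)).nullMeasurableSet)
      (by
        rintro i j hij ξ ⟨hξ, x', hx', hlt⟩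
        exact ⟨hξ, x', ⟨hx'.1, Metric.ball_subset_ball (hr_anti hij) hx'.2⟩,
          hlt.trans_le (hr_anti hij)⟩) ⟨0, measure_ne_top _ _⟩
    have e : ⋂ k, C.outerEvent x (r k) = {ξ ∈ C.Ξ | C.hbar x ξ ≤ 0} := by
      ext ξ
      simp only [Set.mem_iInter, Set.mem_ofPred_eq]
      constructor
      · intro h
        refine ⟨(h 0).1, ?_⟩
        by_contra! hpos
        -- Only the lower endpoint matters: near `x` the constraint value stays above half its
        -- positive value at `x`.
        have h₁ := hcont ξ (h 0).1 (C.hbar x ξ / 2, C.hbar x ξ + 1)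
          ⟨by dsimp only; linarith, by dsimp only; linarith⟩
        have h₂ := hr_lim.eventually (gt_mem_nhds (half_pos hpos))
        obtain ⟨k, hk₁, hk₂⟩ := (h₁.and h₂).exists
        obtain ⟨-, x', hx', hlt⟩ := h k
        have := (hk₁ x' hx').1
        dsimp only at this
        linarith
      · rintro ⟨hξ, hle⟩ k
        exact ⟨hξ, x, ⟨hx, Metric.mem_ball_self (hr k)⟩, hle.trans_lt (hr k)⟩
    rw [e] at hlim
    rw [C.satProb_eq_measureReal hx]
    exact (ENNReal.tendsto_toReal (measure_ne_top _ _)).comp hlim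
  have hinner : Tendsto (fun k => C.law.real (C.innerEvent x (r k))) atTop (𝓝 (C.satProb x)) := by
    have hlim := tendsto_measure_iUnion_atTop (μ := C.law) (s := fun k => C.innerEvent x (r k))
      (by
        rintro i j hij ξ ⟨hξ, h⟩
        exact ⟨hξ, fun x' hx' => (h x' ⟨hx'.1,
          Metric.ball_subset_ball (hr_anti hij) hx'.2⟩).trans (neg_le_neg (hr_anti hij))⟩)
    -- The union misses the samples with `C.hbar x ξ = 0`. They are null by `h_null`, since almost
    -- every sample has positive density and so lies in the support.
    have e : (⋃ k, C.innerEvent x (r k) : Set _) =ᵐ[C.law] {ξ ∈ C.Ξ | C.hbar x ξ ≤ 0} := by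
      have hz : ∀ᵐ ξ ∂C.law, ¬ (ξ ∈ closure {ξ ∈ C.Ξ | 0 < C.p ξ} ∧ C.hbar x ξ = 0) :=
        measure_eq_zero_iff_ae_notMem.1 (h_null x hx)
      filter_upwards [hz, C.ae_law_mem_and_pos] with ξ h₁ h₂
      have hne : C.hbar x ξ ≠ 0 := fun h => h₁ ⟨subset_closure h₂, h⟩
      refine propext ?_
      change ξ ∈ (⋃ k, C.innerEvent x (r k)) ↔ ξ ∈ C.Ξ ∧ C.hbar x ξ ≤ 0
      simp only [Set.mem_iUnion]
      constructor
      · rintro ⟨k, hξ, h⟩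
        exact ⟨hξ, (h x ⟨hx, Metric.mem_ball_self (hr k)⟩).trans (neg_nonpos.2 (hr k).le)⟩
      · rintro ⟨hξ, hle⟩
        have hneg : C.hbar x ξ < 0 := lt_of_le_of_ne hle hne
        have h₃ := hcont ξ hξ (C.hbar x ξ - 1, C.hbar x ξ / 2)
          ⟨by dsimp only; linarith, by dsimp only; linarith⟩
        have h₄ := hr_lim.eventually (gt_mem_nhds (show 0 < -(C.hbar x ξ) / 2 by linarith))
        obtain ⟨k, hk₁, hk₂⟩ := (h₃.and h₄).exists
        refine ⟨k, hξ, fun x' hx' => ?_⟩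
        have := (hk₁ x' hx').2
        dsimp only at this
        linarith
    rw [measure_congr e] at hlim
    rw [C.satProb_eq_measureReal hx]
    exact (ENNReal.tendsto_toReal (measure_ne_top _ _)).comp hlim
  obtain ⟨k, h₁, h₂⟩ := ((houter.eventually (gt_mem_nhds (lt_add_of_pos_right _ hδ))).and
    (hinner.eventually (lt_mem_nhds (sub_lt_self _ hδ)))).exists
  exact ⟨r k, hr k, h₁, h₂⟩

theorem innerEvent_subset {x x' : EuclideanSpace ℝ (Fin n)} {r : ℝ} (hr : 0 < r)
    (hx' : x' ∈ C.X ∩ Metric.ball x r) : C.innerEvent x r ⊆ {ξ ∈ C.Ξ | C.hbar x' ξ ≤ 0} :=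
  fun _ h => ⟨h.1, (h.2 x' hx').trans (neg_nonpos.2 hr.le)⟩

theorem subset_outerEvent {x x' : EuclideanSpace ℝ (Fin n)} {r : ℝ} (hr : 0 < r)
    (hx' : x' ∈ C.X ∩ Metric.ball x r) : {ξ ∈ C.Ξ | C.hbar x' ξ ≤ 0} ⊆ C.outerEvent x r :=
  fun _ h => ⟨h.1, x', hx', h.2.trans_lt hr⟩

theorem continuousOn_satProb (h_null : C.NullBoundary) : ContinuousOn C.satProb C.X := by
  intro x hx
  rw [ContinuousWithinAt, Metric.tendsto_nhds]
  intro δ hδ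
  obtain ⟨r, hr, h₁, h₂⟩ := C.exists_radius h_null hx hδ
  filter_upwards [self_mem_nhdsWithin, mem_nhdsWithin_of_mem_nhds (Metric.ball_mem_nhds x hr)]
    with x' hx' hball
  have h₃ := measureReal_mono (μ := C.law) (C.innerEvent_subset hr ⟨hx', hball⟩)
  have h₄ := measureReal_mono (μ := C.law) (C.subset_outerEvent hr ⟨hx', hball⟩)
  rw [← C.satProb_eq_measureReal hx'] at h₃ h₄
  rw [Real.dist_eq, abs_lt]
  constructor <;> linarith

/-- The margin `r` in the event absorbs the smoothing width, so the bound depends neither on `ε ≤ r`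
nor on `x'` in the ball. -/
theorem smoothIndicator_le_indicator_outerEvent {ε r : ℝ} {lam : ℝ → ℝ}
    (hlam : IsSmoothingProfile ε lam) (hε : ε ≤ r)
    {x x' : EuclideanSpace ℝ (Fin n)} (hx' : x' ∈ C.X ∩ Metric.ball x r)
    {ξ : EuclideanSpace ℝ (Fin s)} (hξ : ξ ∈ C.Ξ) :
    smoothIndicator ε lam (C.hbar x' ξ) ≤ (C.outerEvent x r).indicator (fun _ => (1 : ℝ)) ξ := by
  by_cases h : ξ ∈ C.outerEvent x r
  · rw [Set.indicator_of_mem h]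
    exact (smoothIndicator_mem_Icc_of_profile hlam _).2
  · rw [Set.indicator_of_notMem h]
    have : r ≤ C.hbar x' ξ := by
      by_contra! h'
      exact h ⟨hξ, x', hx', h'⟩
    rw [smoothIndicator, if_pos (hε.trans this)]

theorem indicator_innerEvent_le_smoothIndicator {ε r : ℝ} {lam : ℝ → ℝ} (hε₀ : 0 < ε)
    (hlam : IsSmoothingProfile ε lam) (hε : ε ≤ r)
    {x x' : EuclideanSpace ℝ (Fin n)} (hx' : x' ∈ C.X ∩ Metric.ball x r)
    (ξ : EuclideanSpace ℝ (Fin s)) :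
    (C.innerEvent x r).indicator (fun _ => (1 : ℝ)) ξ ≤ smoothIndicator ε lam (C.hbar x' ξ) := by
  by_cases h : ξ ∈ C.innerEvent x r
  · rw [Set.indicator_of_mem h]
    have := h.2 x' hx'
    -- The branch `ε ≤ y` is tested first; `0 < ε` excludes it when `y ≤ -r`.
    rw [smoothIndicator, if_neg (by linarith), if_pos (by linarith)]
  · rw [Set.indicator_of_notMem h]
    exact (smoothIndicator_mem_Icc_of_profile hlam _).1

/-! ### Uniform law of large numbers. -/

/-- The strong law of large numbers for the frequency of an event. -/
theorem ae_tendsto_frequency {Ω E : Type*} [MeasurableSpace Ω] [MeasurableSpace E] {Pr : Measure Ω}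
    [IsProbabilityMeasure Pr] {ν : Measure E} {ξ : ℕ → Ω → E}
    (h_law : ∀ j, HasLaw (ξ j) ν Pr) (h_indep : iIndepFun ξ Pr) {A : Set E}
    (hA : MeasurableSet A) :
    ∀ᵐ ω ∂Pr, Tendsto (fun N : ℕ => (1 / (N : ℝ)) *
      ∑ j ∈ Finset.range N, A.indicator (fun _ => (1 : ℝ)) (ξ j ω)) atTop (𝓝 (ν.real A)) := by
  have hm : Measurable (A.indicator (fun _ => (1 : ℝ))) := measurable_const.indicator hA
  have hν : IsProbabilityMeasure ν := (h_law 0).map_eq ▸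
    Measure.isProbabilityMeasure_map (h_law 0).aemeasurable
  have h₀ : ∫ ω, (A.indicator (fun _ => (1 : ℝ)) ∘ ξ 0) ω ∂Pr = ν.real A := by
    rw [(h_law 0).integral_comp hm.aestronglyMeasurable]
    exact integral_indicator_one hA
  have hint : Integrable (A.indicator (fun _ => (1 : ℝ)) ∘ ξ 0) Pr := by
    refine Integrable.comp_aemeasurable ?_ (h_law 0).aemeasurable
    rw [(h_law 0).map_eq]
    exact (integrable_const _).indicator hA
  have := strong_law_ae_real (fun j => A.indicator (fun _ => (1 : ℝ)) ∘ ξ j) hint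
    (fun i j hij => (h_indep.indepFun hij).comp hm hm)
    (fun i => IdentDistrib.comp ⟨(h_law i).aemeasurable, (h_law 0).aemeasurable,
      (h_law i).map_eq.trans (h_law 0).map_eq.symm⟩ hm)
  rw [h₀] at this
  filter_upwards [this] with ω hω
  refine hω.congr fun N => ?_
  rw [div_eq_mul_inv, mul_comm, one_div]
  rfl

/-- Almost surely, the smoothed empirical satisfaction probabilities converge uniformly on `X`. -/
theorem ae_uniform_sampleSatProb (h_null : C.NullBoundary)
    {lam : ℝ → ℝ → ℝ} (h_lam : ∀ ε > 0, IsSmoothingProfile ε (lam ε))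
    {Ω : Type*} [MeasurableSpace Ω] {Pr : Measure Ω} [IsProbabilityMeasure Pr]
    {ξ : ℕ → Ω → EuclideanSpace ℝ (Fin s)}
    (h_law : ∀ j, HasLaw (ξ j) C.law Pr) (h_indep : iIndepFun ξ Pr) :
    ∀ᵐ ω ∂Pr, (∀ j, ξ j ω ∈ C.Ξ) ∧ ∀ δ > 0, ∀ᶠ q : ℕ × ℝ in atTop ×ˢ 𝓝[>] (0 : ℝ),
      ∀ x ∈ C.X,
        |C.sampleSatProb (lam q.2) 0 q.2 q.1 (fun j => ξ j ω) x - C.satProb x| ≤ δ := by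
  have hmem : ∀ᵐ ω ∂Pr, ∀ j, ξ j ω ∈ C.Ξ := by
    rw [ae_all_iff]
    intro j
    have : ∀ᵐ ξ ∂(Pr.map (ξ j)), ξ ∈ C.Ξ := by
      rw [(h_law j).map_eq]
      exact C.ae_law_mem_and_pos.mono fun _ h => h.1
    exact ae_of_ae_map (h_law j).aemeasurable this
  -- The cover, and hence the exceptional null set, depends on `δ`, so `δ` is fixed before `ω`.
  -- Passing through the ball's centre costs `δ` for the frequency and `δ` for `C.satProb x'`; `3 *
  -- δ` leaves slack.
  have hfix : ∀ δ > 0, ∀ᵐ ω ∂Pr, (∀ j, ξ j ω ∈ C.Ξ) → ∀ᶠ q : ℕ × ℝ in atTop ×ˢ 𝓝[>] (0 : ℝ),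
      ∀ x ∈ C.X,
        |C.sampleSatProb (lam q.2) 0 q.2 q.1 (fun j => ξ j ω) x - C.satProb x| ≤ 3 * δ := by
    intro δ hδ
    choose! r hr hro hri using fun x (hx : x ∈ C.X) => C.exists_radius h_null hx hδ
    obtain ⟨t, htX, hcover⟩ := C.isCompact_X.elim_nhds_subcover (fun x => Metric.ball x (r x))
      fun x hx => Metric.ball_mem_nhds x (hr x hx)
    have hae : ∀ᵐ ω ∂Pr, ∀ x ∈ t,
        Tendsto (fun N : ℕ => (1 / (N : ℝ)) * ∑ j ∈ Finset.range N,
          (C.outerEvent x (r x)).indicator (fun _ => (1 : ℝ)) (ξ j ω)) atTop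
            (𝓝 (C.law.real (C.outerEvent x (r x)))) ∧
        Tendsto (fun N : ℕ => (1 / (N : ℝ)) * ∑ j ∈ Finset.range N,
          (C.innerEvent x (r x)).indicator (fun _ => (1 : ℝ)) (ξ j ω)) atTop
            (𝓝 (C.law.real (C.innerEvent x (r x)))) := by
      refine (Finset.eventually_all t).2 fun x _ => ?_
      exact (ae_tendsto_frequency h_law h_indep (C.measurableSet_outerEvent x (r x))).and
        (ae_tendsto_frequency h_law h_indep (C.measurableSet_innerEvent x (r x)))
    filter_upwards [hae] with ω hω hΞ
    have hN : ∀ᶠ N : ℕ in atTop, ∀ x ∈ t,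
        (1 / (N : ℝ)) * ∑ j ∈ Finset.range N,
          (C.outerEvent x (r x)).indicator (fun _ => (1 : ℝ)) (ξ j ω) < C.satProb x + δ ∧
        C.satProb x - δ < (1 / (N : ℝ)) * ∑ j ∈ Finset.range N,
          (C.innerEvent x (r x)).indicator (fun _ => (1 : ℝ)) (ξ j ω) :=
      (Finset.eventually_all t).2 fun x hx =>
        ((hω x hx).1.eventually (gt_mem_nhds (hro x (htX x hx)))).and
          ((hω x hx).2.eventually (lt_mem_nhds (hri x (htX x hx))))
    have hε : ∀ᶠ ε in 𝓝[>] (0 : ℝ), 0 < ε ∧ ∀ x ∈ t, ε < r x :=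
      Eventually.and (eventually_mem_nhdsWithin (a := (0 : ℝ)) (s := Set.Ioi 0))
        ((Finset.eventually_all t).2 fun x hx =>
          eventually_nhdsWithin_of_eventually_nhds (gt_mem_nhds (hr x (htX x hx))))
    filter_upwards [hN.prod_mk hε] with q hq x' hx'
    obtain ⟨hq₁, hq₀, hq₂⟩ := hq
    obtain ⟨x, hxt, hball⟩ := Set.mem_iUnion₂.1 (hcover hx')
    have hrx := hr x (htX x hxt)
    have h₁ := (hq₁ x hxt).1
    have h₂ := (hq₁ x hxt).2
    have h₃ := measureReal_mono (μ := C.law) (C.innerEvent_subset hrx ⟨hx', hball⟩)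
    have h₄ := measureReal_mono (μ := C.law) (C.subset_outerEvent hrx ⟨hx', hball⟩)
    rw [← C.satProb_eq_measureReal hx'] at h₃ h₄
    have h₅ := hro x (htX x hxt)
    have h₆ := hri x (htX x hxt)
    have hpos : (0 : ℝ) ≤ 1 / (q.1 : ℝ) := by positivity
    have hup : C.sampleSatProb (lam q.2) 0 q.2 q.1 (fun j => ξ j ω) x' ≤
        (1 / (q.1 : ℝ)) * ∑ j ∈ Finset.range q.1,
          (C.outerEvent x (r x)).indicator (fun _ => (1 : ℝ)) (ξ j ω) := by
      refine mul_le_mul_of_nonneg_left (Finset.sum_le_sum fun j _ => ?_) hpos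
      rw [add_zero]
      exact C.smoothIndicator_le_indicator_outerEvent (h_lam _ hq₀) (hq₂ x hxt).le ⟨hx', hball⟩
        (hΞ j)
    have hlow : (1 / (q.1 : ℝ)) * ∑ j ∈ Finset.range q.1,
          (C.innerEvent x (r x)).indicator (fun _ => (1 : ℝ)) (ξ j ω) ≤
        C.sampleSatProb (lam q.2) 0 q.2 q.1 (fun j => ξ j ω) x' := by
      refine mul_le_mul_of_nonneg_left (Finset.sum_le_sum fun j _ => ?_) hpos
      rw [add_zero]
      exact C.indicator_innerEvent_le_smoothIndicator hq₀ (h_lam _ hq₀) (hq₂ x hxt).le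
        ⟨hx', hball⟩ (ξ j ω)
    rw [abs_le]
    constructor <;> linarith
  -- Countably many tolerances suffice, so the null sets can be united.
  have hall : ∀ᵐ ω ∂Pr, ∀ k : ℕ, (∀ j, ξ j ω ∈ C.Ξ) →
      ∀ᶠ q : ℕ × ℝ in atTop ×ˢ 𝓝[>] (0 : ℝ), ∀ x ∈ C.X,
        |C.sampleSatProb (lam q.2) 0 q.2 q.1 (fun j => ξ j ω) x - C.satProb x| ≤
          3 * (1 / ((k : ℝ) + 1)) :=
    ae_all_iff.2 fun k => hfix _ Nat.one_div_pos_of_nat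
  filter_upwards [hmem, hall] with ω h₁ h₂
  refine ⟨h₁, fun δ hδ => ?_⟩
  obtain ⟨k, hk⟩ := exists_nat_one_div_lt (show 0 < δ / 3 by linarith)
  filter_upwards [h₂ k h₁] with q hq x hx
  exact (hq x hx).trans (by linarith)

theorem continuousOn_sampleSatProb {ε : ℝ} {lam : ℝ → ℝ} (hlam : IsSmoothingProfile ε lam) (γ : ℝ)
    (N : ℕ) {ξ : ℕ → EuclideanSpace ℝ (Fin s)} (hξ : ∀ j, ξ j ∈ C.Ξ) :
    ContinuousOn (C.sampleSatProb lam γ ε N ξ) C.X := by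
  refine continuousOn_const.mul (continuousOn_finsetSum _ fun j _ => ?_)
  exact hlam.contDiff.continuous.comp_continuousOn
    ((C.continuousOn_hbar_left (hξ j)).add continuousOn_const)

end ChanceProblem

/-! ### Lagrange multiplier. -/

/-- The Lagrange multiplier of a two-point problem with value at least `V` and a strictly feasible
point: the affine function of slope `l` supports the graph of the objective. -/
theorem exists_multiplier {E : Type*} {S : Set E} {J P : E → ℝ} {c V : ℝ}
    (hV : ∀ x ∈ S, ∀ y ∈ S, ∀ w ∈ Set.Icc (0 : ℝ) 1, c ≤ P x * w + P y * (1 - w) →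
      V ≤ J x * w + J y * (1 - w))
    {x₀ : E} (hx₀ : x₀ ∈ S) (hP₀ : c < P x₀) :
    ∃ l : ℝ, 0 ≤ l ∧ ∀ x ∈ S, V + l * (P x - c) ≤ J x := by
  have hone : ∀ x ∈ S, c ≤ P x → V ≤ J x := fun x hx h => by
    simpa using hV x hx x hx 1 ⟨zero_le_one, le_rfl⟩ (by simpa using h)
  -- Each `y` with `P y < c` forces a lower bound on the slope; each `x` with `P x > c` forces an
  -- upper one. The inserted `0` makes the supremum nonnegative and `T` nonempty.
  let T : Set ℝ := insert 0 ((fun y => (V - J y) / (c - P y)) '' {y ∈ S | P y < c})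
  have hT : ∀ x ∈ S, c < P x → ∀ t ∈ T, t ≤ (J x - V) / (P x - c) := by
    rintro x hx hPx t (rfl | ⟨y, ⟨hy, hPy⟩, rfl⟩)
    · exact div_nonneg (sub_nonneg.2 (hone x hx hPx.le)) (sub_pos.2 hPx).le
    · have hpos : 0 < P x - P y := by linarith
      have hne := hpos.ne'
      -- This weight makes the mixture of `P x` and `P y` exactly `c`.
      have key := hV x hx y hy ((c - P y) / (P x - P y))
        ⟨div_nonneg (by linarith) hpos.le, (div_le_one hpos).2 (by linarith)⟩
        (le_of_eq (by field_simp; ring))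
      have e : J x * ((c - P y) / (P x - P y)) + J y * (1 - (c - P y) / (P x - P y)) =
          (J x * (c - P y) + J y * (P x - c)) / (P x - P y) := by
        field_simp
        ring
      rw [e, le_div_iff₀ hpos] at key
      dsimp only
      rw [div_le_div_iff₀ (by linarith) (by linarith)]
      linarith
  have hbdd : BddAbove T := ⟨_, fun t ht => hT x₀ hx₀ hP₀ t ht⟩
  have hne : T.Nonempty := ⟨0, Set.mem_insert _ _⟩
  refine ⟨sSup T, le_csSup hbdd (Set.mem_insert _ _), fun x hx => ?_⟩
  rcases lt_trichotomy (P x) c with h | h | h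
  · have := le_csSup hbdd (Set.mem_insert_of_mem 0 (Set.mem_image_of_mem
      (fun y => (V - J y) / (c - P y)) (show x ∈ {y ∈ S | P y < c} from ⟨hx, h⟩)))
    rw [div_le_iff₀ (by linarith)] at this
    linarith
  · have := hone x hx h.ge
    rw [h]
    linarith
  · have := csSup_le hne (hT x hx h)
    rw [le_div_iff₀ (by linarith)] at this
    linarith

/-! ### Two-point decisions: compactness, minimizers, associated measures. -/

namespace TwoPoint

variable {n : ℕ}

/-- The average of `F` over the two points of `z`. -/
def mix (F : EuclideanSpace ℝ (Fin n) → ℝ) (z : TwoPoint n) : ℝ :=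
  ∑ i, F (z.point i) * z.weight i

/-- The two-point decision choosing `x` with weight `w` and `y` with weight `1 - w`. -/
def mk (w : ℝ) (x y : EuclideanSpace ℝ (Fin n)) : TwoPoint n :=
  WithLp.toLp 2 (WithLp.toLp 2 ![w, 1 - w], WithLp.toLp 2 ![x, y])

theorem mix_mk (F : EuclideanSpace ℝ (Fin n) → ℝ) (w : ℝ) (x y : EuclideanSpace ℝ (Fin n)) :
    mix F (mk w x y) = F x * w + F y * (1 - w) := by
  simp [mix, mk, Fin.sum_univ_two, weight, point]

theorem continuous_weight (i : Fin 2) : Continuous fun z : TwoPoint n => z.weight i :=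
  (EuclideanSpace.proj (𝕜 := ℝ) i).continuous.comp (WithLp.continuous_fst 2 _ _)

theorem continuous_point (i : Fin 2) : Continuous fun z : TwoPoint n => z.point i :=
  (PiLp.continuous_apply 2 (fun _ : Fin 2 => EuclideanSpace ℝ (Fin n)) i).comp
    (WithLp.continuous_snd 2 _ _)

end TwoPoint

namespace ChanceProblem

variable {n s m : ℕ} (C : ChanceProblem n s m)

theorem mk_mem_twoPointSet {w : ℝ} (hw : w ∈ Set.Icc (0 : ℝ) 1) {x y : EuclideanSpace ℝ (Fin n)}
    (hx : x ∈ C.X) (hy : y ∈ C.X) : TwoPoint.mk w x y ∈ C.twoPointSet := by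
  refine ⟨fun i => ?_, ?_, fun i => ?_⟩
  · fin_cases i
    · exact hw
    · exact ⟨sub_nonneg.2 hw.2, sub_le_self _ hw.1⟩
  · simp [TwoPoint.mk, TwoPoint.weight, Fin.sum_univ_two]
  · fin_cases i
    · exact hx
    · exact hy

theorem isCompact_twoPointSet : IsCompact C.twoPointSet := by
  let f : (Fin 2 → ℝ) × (Fin 2 → EuclideanSpace ℝ (Fin n)) → TwoPoint n :=
    fun q => WithLp.toLp 2 (WithLp.toLp 2 q.1, WithLp.toLp 2 q.2)
  have hf : Continuous f :=
    (WithLp.prod_continuous_toLp 2 _ _).comp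
      (((PiLp.continuous_toLp 2 _).comp continuous_fst).prodMk
        ((PiLp.continuous_toLp 2 _).comp continuous_snd))
  have hK : IsCompact (stdSimplex ℝ (Fin 2) ×ˢ
      Set.univ.pi fun _ : Fin 2 => C.X) :=
    (isCompact_stdSimplex ℝ (Fin 2)).prod (isCompact_univ_pi fun _ => C.isCompact_X)
  convert hK.image hf using 1
  ext z
  constructor
  · rintro ⟨h₁, h₂, h₃⟩
    exact ⟨(fun i => z.weight i, fun i => z.point i), ⟨⟨fun i => (h₁ i).1, h₂⟩, fun i _ => h₃ i⟩, rfl⟩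
  · rintro ⟨⟨w, x⟩, ⟨hw, hx⟩, rfl⟩
    exact ⟨fun i => mem_Icc_of_mem_stdSimplex hw i, hw.2, fun i => hx i (Set.mem_univ i)⟩

theorem continuousOn_mix {F : EuclideanSpace ℝ (Fin n) → ℝ} (hF : ContinuousOn F C.X) :
    ContinuousOn (TwoPoint.mix F) C.twoPointSet :=
  continuousOn_finsetSum _ fun i _ =>
    (hF.comp (TwoPoint.continuous_point i).continuousOn fun _ hz => hz.2.2 i).mul
      (TwoPoint.continuous_weight i).continuousOn

theorem continuousOn_twoPointObjective : ContinuousOn C.twoPointObjective C.twoPointSet :=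
  C.continuousOn_mix C.continuousOn_J

/-- Convex averaging does not enlarge a uniform error, so estimates on `X` carry over to the
two-point constraint. -/
theorem mix_sub_le {F G : EuclideanSpace ℝ (Fin n) → ℝ} {δ : ℝ}
    (h : ∀ x ∈ C.X, |F x - G x| ≤ δ) {z : TwoPoint n} (hz : z ∈ C.twoPointSet) :
    |TwoPoint.mix F z - TwoPoint.mix G z| ≤ δ := by
  unfold TwoPoint.mix
  rw [← Finset.sum_sub_distrib]
  calc |∑ i, (F (z.point i) * z.weight i - G (z.point i) * z.weight i)|
      ≤ ∑ i, |F (z.point i) * z.weight i - G (z.point i) * z.weight i| :=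
        Finset.abs_sum_le_sum_abs _ _
    _ ≤ ∑ i, δ * z.weight i := Finset.sum_le_sum fun i _ => by
        rw [← sub_mul, abs_mul, abs_of_nonneg (hz.1 i).1]
        exact mul_le_mul_of_nonneg_right (h _ (hz.2.2 i)) (hz.1 i).1
    _ = δ := by rw [← Finset.mul_sum, hz.2.1, mul_one]

theorem bddBelow_twoPointObjective {A : Set (TwoPoint n)} (hA : A ⊆ C.twoPointSet) :
    BddBelow (C.twoPointObjective '' A) :=
  (C.isCompact_twoPointSet.bddBelow_image C.continuousOn_twoPointObjective).mono
    (Set.image_mono hA)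

/-- A two-point problem with a continuous constraint and a feasible point has a solution. -/
theorem exists_twoPoint_minimizer {F : EuclideanSpace ℝ (Fin n) → ℝ} (hF : ContinuousOn F C.X)
    {c : ℝ} {z₀ : TwoPoint n} (hz₀ : z₀ ∈ C.twoPointSet) (hc : c ≤ TwoPoint.mix F z₀) :
    ∃ z ∈ {z ∈ C.twoPointSet | c ≤ TwoPoint.mix F z},
      C.twoPointObjective z =
        sInf (C.twoPointObjective '' {z ∈ C.twoPointSet | c ≤ TwoPoint.mix F z}) := by
  have hK : IsCompact {z ∈ C.twoPointSet | c ≤ TwoPoint.mix F z} :=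
    C.isCompact_twoPointSet.of_isClosed_subset
      ((C.continuousOn_mix hF).preimage_isClosed_of_isClosed C.isCompact_twoPointSet.isClosed
        isClosed_Ici) fun _ h => h.1
  obtain ⟨z, hz, h⟩ := hK.exists_sInf_image_eq ⟨z₀, hz₀, hc⟩
    (C.continuousOn_twoPointObjective.mono fun _ h => h.1)
  exact ⟨z, hz, h.symm⟩

theorem integrable_of_continuousOn {F : EuclideanSpace ℝ (Fin n) → ℝ} (hF : ContinuousOn F C.X)
    (μ : ProbabilityMeasure C.X) : Integrable (fun x : C.X => F x) (μ : Measure C.X) := by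
  have := isCompact_iff_compactSpace.1 C.isCompact_X
  exact (continuousOn_iff_continuous_domRestrict.1 hF).integrable_of_hasCompactSupport
    (HasCompactSupport.of_compactSpace _)

/-- The distribution on `X` of a two-point decision. -/
theorem exists_measure_of_twoPoint {z : TwoPoint n} (hz : z ∈ C.twoPointSet) :
    ∃ μ : ProbabilityMeasure C.X, ∀ F : EuclideanSpace ℝ (Fin n) → ℝ,
      ∫ x : C.X, F x ∂(μ : Measure C.X) = TwoPoint.mix F z := by
  let μ : Measure C.X := ∑ i, ENNReal.ofReal (z.weight i) • Measure.dirac ⟨z.point i, hz.2.2 i⟩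
  have hμ : IsProbabilityMeasure μ := by
    constructor
    simp only [μ, Measure.finsetSum_apply, Measure.smul_apply, measure_univ, smul_eq_mul, mul_one]
    rw [← ENNReal.ofReal_sum_of_nonneg fun i _ => (hz.1 i).1, hz.2.1, ENNReal.ofReal_one]
  refine ⟨⟨μ, hμ⟩, fun F => ?_⟩
  change ∫ x : C.X, F x ∂μ = _
  rw [integral_finsetSum_measure fun i _ =>
    (integrable_dirac (by simp)).smul_measure ENNReal.ofReal_ne_top]
  refine Finset.sum_congr rfl fun i _ => ?_
  rw [integral_smul_measure, integral_dirac, ENNReal.toReal_ofReal (hz.1 i).1, smul_eq_mul,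
    mul_comm]

/-! ### Measures versus two-point decisions. -/

variable [NeZero m]

theorem twoPointValue_le {α : ℝ} {z : TwoPoint n} (hz : z ∈ C.twoPointFeasible α) :
    C.twoPointValue α ≤ C.twoPointObjective z :=
  csInf_le (C.bddBelow_twoPointObjective fun _ h => h.1) (Set.mem_image_of_mem _ hz)

/-- No feasible probability measure beats the optimal two-point decision. -/
theorem twoPointValue_le_measObjective (h_null : C.NullBoundary) {α : ℝ}
    {x₀ : EuclideanSpace ℝ (Fin n)} (hx₀ : x₀ ∈ C.X) (hP₀ : 1 - α < C.satProb x₀)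
    {μ : ProbabilityMeasure C.X} (hμ : 1 - α ≤ C.measSatProb μ) :
    C.twoPointValue α ≤ C.measObjective μ := by
  obtain ⟨l, hl, h⟩ := exists_multiplier (S := C.X) (J := C.J) (P := C.satProb) (c := 1 - α)
    (V := C.twoPointValue α) (fun x hx y hy w hw hc => by
      have := C.twoPointValue_le (α := α) (z := TwoPoint.mk w x y)
        ⟨C.mk_mem_twoPointSet hw hx hy, hc.trans_eq (TwoPoint.mix_mk _ _ _ _).symm⟩
      exact this.trans_eq (TwoPoint.mix_mk C.J _ _ _)) hx₀ hP₀
  have hP := C.integrable_of_continuousOn (C.continuousOn_satProb h_null) μ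
  have hPc : Integrable (fun x : C.X => C.satProb x - (1 - α)) (μ : Measure C.X) :=
    hP.sub (integrable_const _)
  have hint : ∫ x : C.X, (C.twoPointValue α + l * (C.satProb x - (1 - α))) ∂(μ : Measure C.X) =
      C.twoPointValue α + l * (C.measSatProb μ - (1 - α)) := by
    rw [integral_add (integrable_const _) (hPc.const_mul l), integral_const_mul,
      integral_sub hP (integrable_const _)]
    simp [measSatProb]
  -- The supporting inequality is integrated against `μ`; feasibility of `μ` makes the multiplier
  -- term nonnegative.
  have hmono : ∫ x : C.X, (C.twoPointValue α + l * (C.satProb x - (1 - α))) ∂(μ : Measure C.X) ≤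
      C.measObjective μ :=
    integral_mono ((integrable_const _).add (hPc.const_mul l))
      (C.integrable_of_continuousOn C.continuousOn_J μ) fun x => h x x.2
  rw [hint] at hmono
  have := mul_nonneg hl (sub_nonneg.2 hμ)
  linarith

/-- An average above `c` needs a value above `c`. This supplies the strictly feasible point required
by the multiplier. -/
theorem exists_satProb_gt (h_null : C.NullBoundary) {c : ℝ} {μ : ProbabilityMeasure C.X}
    (hμ : c < C.measSatProb μ) : ∃ x ∈ C.X, c < C.satProb x := by
  by_contra! h
  have := integral_mono (C.integrable_of_continuousOn (C.continuousOn_satProb h_null) μ)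
    (integrable_const c) fun x => h x x.2
  rw [integral_const, probReal_univ, one_smul] at this
  exact absurd hμ (not_lt.2 this)

theorem exists_mem_twoPointOptimal (h_null : C.NullBoundary) {α : ℝ}
    {x₀ : EuclideanSpace ℝ (Fin n)} (hx₀ : x₀ ∈ C.X) (hP₀ : 1 - α < C.satProb x₀) :
    (C.twoPointOptimal α).Nonempty := by
  obtain ⟨z, hz, h⟩ := C.exists_twoPoint_minimizer (C.continuousOn_satProb h_null)
    (C.mk_mem_twoPointSet (w := 1) ⟨zero_le_one, le_rfl⟩ hx₀ hx₀)
    (c := 1 - α) (by rw [TwoPoint.mix_mk]; linarith)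
  exact ⟨z, hz, h⟩

theorem measValue_eq_twoPointValue (h_null : C.NullBoundary) {α : ℝ}
    {x₀ : EuclideanSpace ℝ (Fin n)} (hx₀ : x₀ ∈ C.X) (hP₀ : 1 - α < C.satProb x₀) :
    C.measValue α = C.twoPointValue α := by
  obtain ⟨z, hz, hval⟩ := C.exists_mem_twoPointOptimal h_null hx₀ hP₀
  obtain ⟨μ, hμ⟩ := C.exists_measure_of_twoPoint hz.1
  have hfeas : μ ∈ C.measFeasible α := hz.2.trans_eq (hμ C.satProb).symm
  have hobj : C.measObjective μ = C.twoPointValue α := (hμ C.J).trans hval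
  have hlb : ∀ v ∈ C.measObjective '' C.measFeasible α, C.twoPointValue α ≤ v := by
    rintro _ ⟨ν, hν, rfl⟩
    exact C.twoPointValue_le_measObjective h_null hx₀ hP₀ hν
  refine le_antisymm ?_ (le_csInf ⟨_, μ, hfeas, rfl⟩ hlb)
  exact (csInf_le ⟨_, hlb⟩ (Set.mem_image_of_mem _ hfeas)).trans_eq hobj

/-! ### Strict feasibility and stability. -/

/-- The optimal two-point value is approached by strictly feasible two-point decisions. -/
theorem exists_strictly_feasible (h_null : C.NullBoundary) {α : ℝ}
    (h_meas : C.MeasApproximable α) {δ : ℝ} (hδ : 0 < δ) :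
    ∃ z ∈ C.twoPointSet, 1 - α < TwoPoint.mix C.satProb z ∧
      C.twoPointObjective z ≤ C.measValue α + δ := by
  obtain ⟨μ', hμ', H⟩ := h_meas
  obtain ⟨μ, -, hμ, hdist⟩ := H δ hδ
  have hdist' := (abs_le.1 hdist).2
  rw [hμ'.2] at hdist'
  -- `1 - α'` is the midpoint of `1 - α` and `C.measSatProb μ`: `μ` is strictly feasible at level
  -- `α'`, and every `α'`-feasible decision is strictly feasible at level `α`.
  let α' := 1 - (1 - α + C.measSatProb μ) / 2
  have hα' : 1 - α' = (1 - α + C.measSatProb μ) / 2 := by simp [α']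
  have h₁ : 1 - α' < C.measSatProb μ := by rw [hα']; linarith
  have h₂ : 1 - α < 1 - α' := by rw [hα']; linarith
  obtain ⟨x₀, hx₀, hP₀⟩ := C.exists_satProb_gt h_null h₁
  obtain ⟨z, hz, hval⟩ := C.exists_mem_twoPointOptimal h_null hx₀ hP₀
  refine ⟨z, hz.1, h₂.trans_le hz.2, ?_⟩
  have := C.twoPointValue_le_measObjective h_null hx₀ hP₀ h₁.le
  rw [← hval] at this
  linarith

/-- Nearly feasible, nearly optimal two-point decisions are close to `D_α`. -/
theorem exists_stability_radius (h_null : C.NullBoundary) (α : ℝ) {η : ℝ} (hη : 0 < η) :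
    ∃ δ > 0, δ < η ∧ ∀ z ∈ C.twoPointSet, 1 - α - δ ≤ TwoPoint.mix C.satProb z →
      C.twoPointObjective z ≤ C.twoPointValue α + δ →
      Metric.infDist z (C.twoPointOptimal α) < η ∧
        C.twoPointValue α - η < C.twoPointObjective z := by
  -- `0 ≤ ψ z` says that the desired conclusion fails at `z`, while `φ z ≤ 0` says that `z` is
  -- optimal. Hence `φ` is positive on the compact set where `0 ≤ ψ`, and bounded below there by
  -- some `d > 0`.
  let ψ : TwoPoint n → ℝ := fun z => max (Metric.infDist z (C.twoPointOptimal α) - η)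
    (C.twoPointValue α - η - C.twoPointObjective z)
  let φ : TwoPoint n → ℝ := fun z => max (1 - α - TwoPoint.mix C.satProb z)
    (C.twoPointObjective z - C.twoPointValue α)
  have hψ : ContinuousOn ψ C.twoPointSet :=
    (((Metric.continuous_infDist_pt _).continuousOn).sub continuousOn_const).sup
      (continuousOn_const.sub C.continuousOn_twoPointObjective)
  have hφ : ContinuousOn φ C.twoPointSet :=
    (continuousOn_const.sub (C.continuousOn_mix (C.continuousOn_satProb h_null))).sup
      (C.continuousOn_twoPointObjective.sub continuousOn_const)
  have hK : IsCompact {z ∈ C.twoPointSet | 0 ≤ ψ z} :=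
    C.isCompact_twoPointSet.of_isClosed_subset
      (hψ.preimage_isClosed_of_isClosed C.isCompact_twoPointSet.isClosed isClosed_Ici)
      fun _ h => h.1
  have hpos : ∀ z ∈ {z ∈ C.twoPointSet | 0 ≤ ψ z}, 0 < φ z := by
    rintro z ⟨hz, hz'⟩
    by_contra! hle
    obtain ⟨h₁, h₂⟩ := max_le_iff.1 hle
    have hfeas : z ∈ C.twoPointFeasible α := ⟨hz, sub_nonpos.1 h₁⟩
    have hval := C.twoPointValue_le hfeas
    have hopt : z ∈ C.twoPointOptimal α := ⟨hfeas, le_antisymm (sub_nonpos.1 h₂) hval⟩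
    rcases le_max_iff.1 hz' with h | h
    · rw [Metric.infDist_zero_of_mem hopt] at h
      linarith
    · linarith
  have hδ : ∃ d > 0, ∀ z ∈ {z ∈ C.twoPointSet | 0 ≤ ψ z}, d ≤ φ z := by
    rcases Set.eq_empty_or_nonempty {z ∈ C.twoPointSet | 0 ≤ ψ z} with he | hne
    · exact ⟨1, one_pos, fun z hz => absurd hz (he ▸ Set.notMem_empty z)⟩
    · obtain ⟨z, hz, hmin⟩ := hK.exists_isMinOn hne (hφ.mono fun _ h => h.1)
      exact ⟨φ z, hpos z hz, fun z' hz' => hmin hz'⟩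
  obtain ⟨d, hd, h⟩ := hδ
  have hmin : 0 < min d η := lt_min hd hη
  refine ⟨min d η / 2, half_pos hmin, (half_lt_self hmin).trans_le (min_le_right _ _),
    fun z hz h₁ h₂ => ?_⟩
  have hlt : φ z < d := by
    have : min d η / 2 < d := (half_lt_self hmin).trans_le (min_le_left _ _)
    exact max_lt (by linarith) (by linarith)
  have hneg : ψ z < 0 := by
    by_contra! h'
    exact absurd (h z ⟨hz, h'⟩) (not_le.2 hlt)
  obtain ⟨h₃, h₄⟩ := max_lt_iff.1 hneg
  exact ⟨by linarith, by linarith⟩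

end ChanceProblem

/-! ### Convergence of values and solution sets. -/

/-- Nonemptiness matters: `Metric.infDist` to the empty set is `0`, whereas the deviation of a
nonempty set from it is `⊤`. -/
theorem deviation_le_of_infDist_lt {E : Type*} [NormedAddCommGroup E] {A B : Set E}
    (hB : B.Nonempty) {η : ℝ} (h : ∀ z ∈ A, Metric.infDist z B < η) :
    deviation A B ≤ ENNReal.ofReal η := by
  refine iSup₂_le fun z hz => ?_
  have e : ⨅ z' ∈ B, ‖z - z'‖ₑ = Metric.infEDist z B := by
    simp only [Metric.infEDist, edist_eq_enorm_sub]
  rw [e, ← ENNReal.ofReal_toReal (Metric.infEDist_ne_top hB)]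
  exact ENNReal.ofReal_le_ofReal (h z hz).le

theorem mainTheorem5 {n s m : ℕ} [NeZero m] (C : ChanceProblem n s m)
    (α : ℝ) (hα : α ∈ Set.Icc (0 : ℝ) 1)
    (h_null : C.NullBoundary) (h_meas : C.MeasApproximable α) (h_det : C.DetApproximable)
    (lam : ℝ → ℝ → ℝ) (h_lam : ∀ ε > 0, IsSmoothingProfile ε (lam ε))
    {Ω : Type*} [MeasurableSpace Ω] (Pr : Measure Ω) [IsProbabilityMeasure Pr]
    (ξ : ℕ → Ω → EuclideanSpace ℝ (Fin s))
    (h_law : ∀ j, HasLaw (ξ j) C.law Pr) (h_indep : iIndepFun ξ Pr) :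
    ∀ᵐ ω ∂Pr,
      (∀ᶠ q : ℕ × ℝ in atTop ×ˢ 𝓝[>] (0 : ℝ),
        (C.sampleOptimal (lam q.2) α 0 q.2 q.1 (fun j => ξ j ω)).Nonempty) ∧
      Tendsto (fun q : ℕ × ℝ => C.sampleValue (lam q.2) α 0 q.2 q.1 (fun j => ξ j ω))
        (atTop ×ˢ 𝓝[>] (0 : ℝ)) (𝓝 (C.measValue α)) ∧
      Tendsto (fun q : ℕ × ℝ =>
          deviation (C.sampleOptimal (lam q.2) α 0 q.2 q.1 (fun j => ξ j ω)) (C.twoPointOptimal α))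
        (atTop ×ˢ 𝓝[>] (0 : ℝ)) (𝓝 0) := by
  obtain ⟨x₀, hx₀, hP₀⟩ : ∃ x ∈ C.X, 1 - α < C.satProb x := by
    obtain ⟨_, -, H⟩ := h_meas
    obtain ⟨μ, -, hμ, -⟩ := H 1 one_pos
    exact C.exists_satProb_gt h_null hμ
  have hV := C.measValue_eq_twoPointValue h_null hx₀ hP₀
  filter_upwards [C.ae_uniform_sampleSatProb h_null h_lam h_law h_indep] with ω hω
  obtain ⟨hΞ, hunif⟩ := hω
  have hpos : ∀ᶠ q : ℕ × ℝ in atTop ×ˢ 𝓝[>] (0 : ℝ), 0 < q.2 :=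
    tendsto_snd.eventually (eventually_mem_nhdsWithin (a := (0 : ℝ)) (s := Set.Ioi 0))
  have main : ∀ η > 0, ∀ᶠ q : ℕ × ℝ in atTop ×ˢ 𝓝[>] (0 : ℝ),
      (C.sampleOptimal (lam q.2) α 0 q.2 q.1 (fun j => ξ j ω)).Nonempty ∧
      |C.sampleValue (lam q.2) α 0 q.2 q.1 (fun j => ξ j ω) - C.measValue α| < η ∧
      ∀ z ∈ C.sampleOptimal (lam q.2) α 0 q.2 q.1 (fun j => ξ j ω),
        Metric.infDist z (C.twoPointOptimal α) < η := by
    intro η hη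
    obtain ⟨δ, hδ, hδη, hstab⟩ := C.exists_stability_radius h_null α hη
    obtain ⟨z₀, hz₀, hgap, hobj₀⟩ := C.exists_strictly_feasible h_null h_meas hδ
    -- An error below the gap of `z₀` keeps `z₀` feasible for the samples; an error below `δ` makes
    -- every sample-feasible point feasible up to `δ`.
    filter_upwards [hpos, hunif (min δ (TwoPoint.mix C.satProb z₀ - (1 - α)))
      (lt_min hδ (sub_pos.2 hgap))] with q hq hclose
    have hcont := C.continuousOn_sampleSatProb (h_lam q.2 hq) 0 q.1 hΞ
    have hfeas₀ : 1 - α ≤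
        TwoPoint.mix (C.sampleSatProb (lam q.2) 0 q.2 q.1 fun j => ξ j ω) z₀ := by
      have h₁ := (abs_le.1 (C.mix_sub_le hclose hz₀)).1
      have h₂ := min_le_right δ (TwoPoint.mix C.satProb z₀ - (1 - α))
      linarith
    have hle : C.sampleValue (lam q.2) α 0 q.2 q.1 (fun j => ξ j ω) ≤ C.measValue α + δ :=
      (csInf_le (C.bddBelow_twoPointObjective fun _ h => h.1)
        (Set.mem_image_of_mem C.twoPointObjective (show z₀ ∈ C.sampleFeasible (lam q.2) α 0 q.2 q.1
          (fun j => ξ j ω) from ⟨hz₀, hfeas₀⟩))).trans hobj₀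
    have hopt : ∀ z ∈ C.sampleOptimal (lam q.2) α 0 q.2 q.1 (fun j => ξ j ω),
        Metric.infDist z (C.twoPointOptimal α) < η ∧
          C.twoPointValue α - η < C.twoPointObjective z := by
      rintro z ⟨⟨hz, hc⟩, hval⟩
      have hc' : 1 - α ≤
        TwoPoint.mix (C.sampleSatProb (lam q.2) 0 q.2 q.1 fun j => ξ j ω) z := hc
      -- A sample optimum does no worse than `z₀`, so its objective is within the tolerance `δ`
      -- above the true value.
      refine hstab z hz ?_ (by rw [hval, ← hV]; exact hle)
      have h₁ := (abs_le.1 (C.mix_sub_le hclose hz)).2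
      have h₂ := min_le_left δ (TwoPoint.mix C.satProb z₀ - (1 - α))
      linarith
    obtain ⟨z, hz, hval⟩ := C.exists_twoPoint_minimizer hcont hz₀ hfeas₀
    have hz' : z ∈ C.sampleOptimal (lam q.2) α 0 q.2 q.1 (fun j => ξ j ω) := ⟨hz, hval⟩
    refine ⟨⟨z, hz'⟩, ?_, fun z hz => (hopt z hz).1⟩
    have hlow := (hopt z hz').2
    rw [hz'.2, ← hV] at hlow
    rw [abs_lt]
    constructor <;> linarith
  refine ⟨(main 1 one_pos).mono fun q h => h.1, ?_, ?_⟩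
  · rw [Metric.tendsto_nhds]
    exact fun η hη => (main η hη).mono fun q h => h.2.1
  · rw [ENNReal.tendsto_nhds_zero]
    intro e he
    obtain ⟨η, hη, hηe⟩ : ∃ η : ℝ, 0 < η ∧ ENNReal.ofReal η ≤ e := by
      rcases eq_or_ne e ⊤ with rfl | hne
      · exact ⟨1, one_pos, le_top⟩
      · exact ⟨e.toReal, ENNReal.toReal_pos he.ne' hne, (ENNReal.ofReal_toReal hne).le⟩
    exact (main η hη).mono fun q h =>
      (deviation_le_of_infDist_lt (C.exists_mem_twoPointOptimal h_null hx₀ hP₀) h.2.2).trans hηe
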